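/- Consider a continuous-time homogeneous multi-agent system with agents $\dot x_i=Ax_i+Bu_i$, $y_i=Cx_i$, $i=1,\dots,N$, $N\ge 1$, on a weighted directed graph with weights $a_{ij}\ge 0$, $a_{ii}=0$ ($a_{ij}>0$ meaning an edge from $j$ to $i$) and Laplacian $L$. Each agent measures $\zeta_i=\sum_j a_{ij}(y_i-y_j)$ and uses the same linear protocol $\dot x_{i,c}=A_cx_{i,c}+B_c\zeta_i$, $u_i=F_cx_{i,c}+G_c\zeta_i$. Assume that the protocol is scale-free: for every $N$, every such graph containing a directed spanning tree and all initial conditions of agents and protocols, $x_i(t)-x_j(t)\to 0$ as $t\to\infty$ for all $i,j$. Let $\tilde A=\begin{pmatrix}A&BF_c\\0&A_c\end{pmatrix}$. Apply this protocol on a graph that does not contain a directed spanning tree. Then the graph has $k>1$ basic bicomponents $\mathcal B_1,\dots,\mathcal B_k$ (maximal strongly connected subgraphs without incoming edges). Let $L_i$ be the diagonal block of $L$ for the nodes of $\mathcal B_i$, $L_0$ the diagonal block for the nodes outside all basic bicomponents, and $L_{0,i}$ the block of $L$ with the rows of $L_0$ and the columns of $L_i$. Then $L_0$ is invertible, and the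 coefficients $$(\beta_{j,i})_j=-L_0^{-1}L_{0,i}\mathbf 1,$$ which depend only on the network, are nonnegative and satisfy $\sum_{i=1}^k\beta_{j,i}=1$ for every node $j$ outside the basic bicomponents. Moreover, for every $i$ there are weights $\alpha_l\ge 0$ ($l\in\mathcal B_i$) with $\sum_l\alpha_l=1$ and $\alpha^{\top}L_i=0$, independent of the initial conditions, such that for all initial conditions of agents and protocols the solutions of $$\begin{pmatrix}\dot x_{i,s}\\ \dot x_{i,s,c}\end{pmatrix}=\tilde A\begin{pmatrix}x_{i,s}\\ x_{i,s,c}\end{pmatrix},\qquad \begin{pmatrix}x_{i,s}(0)\\ x_{i,s,c}(0)\end{pmatrix}=\sum_{l\in\mathcal B_i}\alpha_l\begin{pmatrix}x_l(0)\\ x_{l,c}(0)\end{pmatrix}$$ have the following properties as $t\to\infty$. (1) For all $j,l\in\mathcal B_i$: $x_j(t)-x_l(t)\to 0$ and $x_j(t)-x_{i,s}(t)\to 0$. For every node $j$ outside the basic bicomponents: $x_j(t)-\sum_{i=1}^k\beta_{j,i}x_{i,s}(t)\to 0$. (2) If the pair $(BF_c,A_c)$ is detectable (that is, no eigenvector of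 $A_c$ for an eigenvalue with nonnegative real part lies in the kernel of $BF_c$), then the same holds for the protocol states: for all $j,l\in\mathcal B_i$, $x_{j,c}(t)-x_{l,c}(t)\to 0$ and $x_{j,c}(t)-x_{i,s,c}(t)\to 0$, and for every node $j$ outside the basic bicomponents $x_{j,c}(t)-\sum_{i=1}^k\beta_{j,i}x_{i,s,c}(t)\to 0$. -/

import Mathlib

open Filter Topology

noncomputable section

/-- A weighted directed graph on `N` nodes without self-loops. `a i j > 0` means that there is an
edge from node `j` to node `i` of weight `a i j`; `a i j = 0` means that there is no such edge. -/
structure WDigraph (N : ℕ) where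
  a : Matrix (Fin N) (Fin N) ℝ
  nonneg : ∀ i j, 0 ≤ a i j
  no_loop : ∀ i, a i i = 0

namespace WDigraph

variable {N : ℕ} (G : WDigraph N)

/-- There is an edge from `u` to `v`. -/
def Edge (u v : Fin N) : Prop := 0 < G.a v u

/-- The graph contains a directed spanning tree: a subgraph `T` on all the nodes with a root that
has no parent, in which every other node has exactly one parent, and in which the root has a
directed path to every node. -/
def HasDirectedSpanningTree : Prop :=
  ∃ (T : Fin N → Fin N → Prop) (r : Fin N),
    (∀ u v, T u v → G.Edge u v) ∧
    (∀ u, ¬ T u r) ∧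
    (∀ v, v ≠ r → ∃! u, T u v) ∧
    (∀ v, Relation.ReflTransGen T r v)

/-- The Laplacian matrix. -/
def laplacian : Matrix (Fin N) (Fin N) ℝ :=
  fun i j => if i = j then ∑ k, G.a i k else -G.a i j

/-- The subgraph induced on the nonempty node set `S` is strongly connected: it contains a directed
path from every one of its nodes to every other one. -/
def IsStronglyConnectedOn (S : Finset (Fin N)) : Prop :=
  S.Nonempty ∧ ∀ u ∈ S, ∀ v ∈ S,
    Relation.ReflTransGen (fun p q => p ∈ S ∧ q ∈ S ∧ G.Edge p q) u v

/-- A bicomponent (given by its set of nodes): a maximal strongly connected subgraph. -/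
def IsBicomponent (S : Finset (Fin N)) : Prop :=
  Maximal G.IsStronglyConnectedOn S

/-- A basic bicomponent: a bicomponent without incoming edges. -/
def IsBasicBicomponent (S : Finset (Fin N)) : Prop :=
  G.IsBicomponent S ∧ ∀ u, u ∉ S → ∀ v ∈ S, ¬ G.Edge u v

open Classical in
/-- The set of all basic bicomponents; its cardinality is the number `k`. -/
def basicBicomponents : Finset (Finset (Fin N)) :=
  Finset.univ.filter G.IsBasicBicomponent

/-- The nodes that belong to some basic bicomponent. -/
def basicNodes : Finset (Fin N) := G.basicBicomponents.biUnion id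

/-- The nodes that belong to no basic bicomponent. -/
abbrev NonBasic : Type := {j : Fin N // j ∉ G.basicNodes}

/-- The diagonal block `L₀` of the Laplacian, for the nodes outside the basic bicomponents. -/
def L0 : Matrix G.NonBasic G.NonBasic ℝ :=
  G.laplacian.submatrix Subtype.val Subtype.val

/-- The block `L_{0,S}` of the Laplacian: rows outside the basic bicomponents, columns in `S`. -/
def L0block (S : Finset (Fin N)) : Matrix G.NonBasic S ℝ :=
  G.laplacian.submatrix Subtype.val Subtype.val

/-- The diagonal block `L_S` of the Laplacian, for the nodes in `S`. -/
def Lblock (S : Finset (Fin N)) : Matrix S S ℝ :=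
  G.laplacian.submatrix Subtype.val Subtype.val

/-- The column of coefficients `β_{·,S} = - L₀⁻¹ L_{0,S} 𝟏`. -/
def beta (S : Finset (Fin N)) : G.NonBasic → ℝ :=
  Matrix.mulVec (-(G.L0⁻¹ * G.L0block S)) 1

end WDigraph

/-- The agent model `ẋ = A x + B u`, `y = C x`. -/
structure AgentModel (n m p : ℕ) where
  A : Matrix (Fin n) (Fin n) ℝ
  B : Matrix (Fin n) (Fin m) ℝ
  C : Matrix (Fin p) (Fin n) ℝ

/-- The non-collaborative linear protocol `ẋ_c = A_c x_c + B_c ζ`, `u = F_c x_c + G_c ζ`. -/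
structure LinProtocol (nc m p : ℕ) where
  Ac : Matrix (Fin nc) (Fin nc) ℝ
  Bc : Matrix (Fin nc) (Fin p) ℝ
  Fc : Matrix (Fin m) (Fin nc) ℝ
  Gc : Matrix (Fin m) (Fin p) ℝ

section MAS

variable {n m p nc : ℕ}

/-- The relative measurement `ζ_i = ∑ j, a_{ij} (y_i - y_j)`, with `y_i = C x_i`, as a function of
the agent states. -/
def relMeasurement (S : AgentModel n m p) {N : ℕ} (G : WDigraph N) (x : Fin N → Fin n → ℝ)
    (i : Fin N) : Fin p → ℝ :=
  ∑ j, G.a i j • (S.C.mulVec (x i) - S.C.mulVec (x j))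

/-- `x i` and `xc i` (`i = 1, …, N`) are trajectories of the agent states and the protocol states
of the network `G`. -/
def IsTrajectory (S : AgentModel n m p) (P : LinProtocol nc m p) {N : ℕ} (G : WDigraph N)
    (x : Fin N → ℝ → Fin n → ℝ) (xc : Fin N → ℝ → Fin nc → ℝ) : Prop :=
  ∀ (i : Fin N) (t : ℝ),
    let ζ : Fin p → ℝ := relMeasurement S G (fun j => x j t) i
    let u : Fin m → ℝ := P.Fc.mulVec (xc i t) + P.Gc.mulVec ζ
    HasDerivAt (x i) (S.A.mulVec (x i t) + S.B.mulVec u) t ∧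
    HasDerivAt (xc i) (P.Ac.mulVec (xc i t) + P.Bc.mulVec ζ) t

/-- The protocol solves the scale-free non-collaborative state synchronization problem: for every
number of agents, every communication graph that contains a directed spanning tree and all initial
conditions of agents and protocols, `x_i(t) - x_j(t) → 0` for all agents `i`, `j`. -/
def SolvesScaleFree (S : AgentModel n m p) (P : LinProtocol nc m p) : Prop :=
  ∀ (N : ℕ) (G : WDigraph N), G.HasDirectedSpanningTree →
    ∀ (x : Fin N → ℝ → Fin n → ℝ) (xc : Fin N → ℝ → Fin nc → ℝ),
      IsTrajectory S P G x xc →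
      ∀ i j, Tendsto (fun t => x i t - x j t) atTop (𝓝 0)

/-- The matrix `Ã = [A, B F_c; 0, A_c]`. -/
def Atilde (S : AgentModel n m p) (P : LinProtocol nc m p) :
    Matrix (Fin n ⊕ Fin nc) (Fin n ⊕ Fin nc) ℝ :=
  Matrix.fromBlocks S.A (S.B * P.Fc) 0 P.Ac

/-- Detectability of the pair `(H, F)`, i.e. of `ẋ = F x`, `y = H x`: no eigenvector of `F` for an
eigenvalue in the closed right half plane lies in the kernel of `H`. -/
def IsDetectable {q r : ℕ} (H : Matrix (Fin r) (Fin q) ℝ) (F : Matrix (Fin q) (Fin q) ℝ) : Prop :=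
  ∀ (μ : ℂ) (v : Fin q → ℂ), 0 ≤ μ.re →
    (F.map Complex.ofReal).mulVec v = μ • v → (H.map Complex.ofReal).mulVec v = 0 → v = 0

end MAS

end

/-!
Write `z_i = (x_i, x_{i,c})` for the joint state of an agent and its protocol. A network trajectory
satisfies `z_i' = T z_i + M (∑ j, a_{ij} (z_i - z_j))` with `T = Ã` (`drift`) and a coupling map `M`
that only sees the agent states (`isTrajectory_iff`).

*The graph.* The ancestors of a node with as few ancestors as possible form a basic bicomponent, so
that every node is reachable from a basic one (`exists_basic_reach`). This gives the maximum principle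
for the Laplacian with the basic nodes as boundary (`maximum_principle`), from which the
invertibility of `L₀` and the properties of the coefficients `β` follow. The weights `α` are the
normalized absolute values of a left null vector of the diagonal block of the Laplacian.

*Agent states.* The average of `z` over a basic bicomponent `K` with the weights `α` satisfies
`w' = Ã w` (`IsAveraging.hasDerivAt`). Extended by the indicator function of `K`, the coefficients
`β_{·,K}` are in the kernel of the Laplacian, so that the deviation
`e_i = z_i - ∑ K, β_{i,K} w_K` is again a network trajectory, now with average zero over each `K`. By
superposition, `e` is a sum of trajectories `u` that vanish at all the basic nodes outside a single
`K`, with average zero over `K`. If the basic nodes outside `K` are rewired to receive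
only the average over `K`, then they can stay at rest, and `u` is also a trajectory of the rewired
graph. That graph contains a directed spanning tree, so scale-free synchronization applies to
it and brings all the agent states of `u` to the zero state of a node at rest
(`tendsto_zero_of_average_eq_zero`, `tendsto_zero_of_forall_average_eq_zero`).

*Protocol states.* Detectability of `(B F_c, A_c)` makes the agent states a detectable output of the
whole network. For a linear system `z' = A z`, a detectable output tends to zero only if the state
does (`tendsto_zero_of_output_tendsto_zero`), by a decomposition of the invariant subspace of initial
states with vanishing output into generalized eigenvectors.
-/

noncomputable section

/-! ### Spanning trees and basic bicomponents -/

namespace WDigraph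

variable {N : ℕ} (G : WDigraph N)

/-- A node from which all the nodes can be reached is the root of a directed spanning tree: every
other node gets a parent that is closer to the root. -/
theorem hasDirectedSpanningTree_of_root (r : Fin N)
    (hr : ∀ v, Relation.ReflTransGen G.Edge r v) : G.HasDirectedSpanningTree := by
  classical
  let reach : ℕ → Fin N → Prop := fun k =>
    Nat.rec (motive := fun _ => Fin N → Prop) (fun v => v = r) (fun _ S v => ∃ u, S u ∧ G.Edge u v) k
  have hreach : ∀ v, ∃ k, reach k v := by
    intro v
    induction hr v with
    | refl => exact ⟨0, rfl⟩
    | tail _ huv ih =>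
      obtain ⟨k, hk⟩ := ih
      exact ⟨k + 1, _, hk, huv⟩
  -- `d v` is the length of a shortest path from `r` to `v`.
  let d : Fin N → ℕ := fun v => Nat.find (hreach v)
  have hpar : ∀ v, v ≠ r → ∃ u, G.Edge u v ∧ d u < d v := by
    intro v hv
    have h := Nat.find_spec (hreach v)
    change reach (d v) v at h
    rcases hd : d v with _ | k
    · rw [hd] at h
      exact absurd h hv
    · rw [hd] at h
      obtain ⟨u, hu, huv⟩ := h
      exact ⟨u, huv, Nat.lt_succ_of_le (Nat.find_min' (hreach u) hu)⟩
  choose! par hE hlt using hpar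
  refine ⟨fun u v => v ≠ r ∧ u = par v, r, ?_, ?_, ?_, ?_⟩
  · rintro u v ⟨hv, rfl⟩
    exact hE v hv
  · rintro u ⟨h, -⟩
    exact h rfl
  · intro v hv
    exact ⟨par v, ⟨hv, rfl⟩, fun u hu => hu.2⟩
  · intro v
    induction hk : d v using Nat.strong_induction_on generalizing v with
    | _ k ih =>
      by_cases hv : v = r
      · rw [hv]
      · exact (ih (d (par v)) (hk ▸ hlt v hv) (par v) rfl).tail ⟨hv, rfl⟩

theorem mem_basicBicomponents {K : Finset (Fin N)} :
    K ∈ G.basicBicomponents ↔ G.IsBasicBicomponent K := by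
  simp [basicBicomponents]

theorem mem_basicNodes {i : Fin N} :
    i ∈ G.basicNodes ↔ ∃ K ∈ G.basicBicomponents, i ∈ K := by
  simp [basicNodes]

variable {G}

theorem IsBasicBicomponent.mem_of_reach {K : Finset (Fin N)} (hK : G.IsBasicBicomponent K)
    {u v : Fin N} (hv : v ∈ K) (h : Relation.ReflTransGen G.Edge u v) : u ∈ K := by
  induction h using Relation.ReflTransGen.head_induction_on with
  | refl => exact hv
  | head huv _ ih =>
    by_contra hu
    exact hK.2 _ hu _ ih huv

theorem IsBasicBicomponent.reach {K : Finset (Fin N)} (hK : G.IsBasicBicomponent K)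
    {u v : Fin N} (hu : u ∈ K) (hv : v ∈ K) : Relation.ReflTransGen G.Edge u v :=
  Relation.ReflTransGen.mono (fun _ _ h => h.2.2) _ _ (hK.1.prop.2 u hu v hv)

theorem IsBasicBicomponent.eq_of_mem {K K' : Finset (Fin N)} (hK : G.IsBasicBicomponent K)
    (hK' : G.IsBasicBicomponent K') {u : Fin N} (hu : u ∈ K) (hu' : u ∈ K') : K = K' := by
  ext v
  exact ⟨fun hv => hK'.mem_of_reach hu' (hK.reach hv hu),
    fun hv => hK.mem_of_reach hu (hK'.reach hv hu')⟩

theorem IsBasicBicomponent.a_eq_zero {K : Finset (Fin N)} (hK : G.IsBasicBicomponent K)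
    {i j : Fin N} (hi : i ∈ K) (hj : j ∉ K) : G.a i j = 0 :=
  le_antisymm (not_lt.1 (hK.2 j hj i hi)) (G.nonneg i j)

variable (G)

/-- Every node can be reached from a basic bicomponent, namely from the set of the ancestors of
an ancestor with the fewest ancestors. -/
theorem exists_basic_reach (j : Fin N) :
    ∃ b ∈ G.basicNodes, Relation.ReflTransGen G.Edge b j := by
  classical
  let Anc : Fin N → Finset (Fin N) := fun v =>
    Finset.univ.filter fun u => Relation.ReflTransGen G.Edge u v
  have hAnc : ∀ {u v}, u ∈ Anc v ↔ Relation.ReflTransGen G.Edge u v := by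
    intro u v
    simp [Anc]
  obtain ⟨u, huj, hmin⟩ := Finset.exists_min_image (Anc j) (fun u => (Anc u).card)
    ⟨j, hAnc.2 Relation.ReflTransGen.refl⟩
  have huu : u ∈ Anc u := hAnc.2 Relation.ReflTransGen.refl
  have hback : ∀ v ∈ Anc u, Relation.ReflTransGen G.Edge u v := by
    intro v hv
    have hsub : Anc v ⊆ Anc u := fun w hw => hAnc.2 ((hAnc.1 hw).trans (hAnc.1 hv))
    have := Finset.eq_of_subset_of_card_le hsub
      (hmin v (hAnc.2 ((hAnc.1 hv).trans (hAnc.1 huj))))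
    exact hAnc.1 (this ▸ huu)
  have hin : ∀ p, ∀ q ∈ Anc u, Relation.ReflTransGen G.Edge p q →
      Relation.ReflTransGen (fun p q => p ∈ Anc u ∧ q ∈ Anc u ∧ G.Edge p q) p q := by
    intro p q hq h
    induction h using Relation.ReflTransGen.head_induction_on with
    | refl => exact Relation.ReflTransGen.refl
    | head hab hbq ih =>
      have hb := hAnc.2 (hbq.trans (hAnc.1 hq))
      exact ih.head ⟨hAnc.2 ((hAnc.1 hb).head hab), hb, hab⟩
  refine ⟨u, G.mem_basicNodes.2 ⟨Anc u, G.mem_basicBicomponents.2 ⟨⟨⟨⟨u, huu⟩, ?_⟩, ?_⟩, ?_⟩,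
    huu⟩, hAnc.1 huj⟩
  · intro p hp q hq
    exact hin p q hq ((hAnc.1 hp).trans (hback q hq))
  · intro S hS hle v hv
    exact hAnc.2 (Relation.ReflTransGen.mono (fun _ _ h => h.2.2) _ _ (hS.2 v hv u (hle huu)))
  · intro p hp q hq hpq
    exact hp (hAnc.2 ((hAnc.1 hq).head hpq))

theorem one_lt_card_basicBicomponents (hN : 0 < N) (hG : ¬ G.HasDirectedSpanningTree) :
    1 < G.basicBicomponents.card := by
  by_contra hcard
  obtain ⟨b, hb, -⟩ := G.exists_basic_reach ⟨0, hN⟩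
  obtain ⟨K, hK, hbK⟩ := G.mem_basicNodes.1 hb
  refine hG (G.hasDirectedSpanningTree_of_root b fun v => ?_)
  obtain ⟨c, hc, hcv⟩ := G.exists_basic_reach v
  obtain ⟨K', hK', hcK⟩ := G.mem_basicNodes.1 hc
  obtain rfl := Finset.card_le_one.1 (not_lt.1 hcard) K hK K' hK'
  exact ((G.mem_basicBicomponents.1 hK).reach hbK hcK).trans hcv

/-! ### The maximum principle and the coefficients `β` -/

/-- The maximum principle for the Laplacian with the basic bicomponents as the boundary: a positive
maximum would be attained at all the ancestors of a maximizer, one of which is basic. -/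
theorem maximum_principle {f : Fin N → ℝ} (hb : ∀ i ∈ G.basicNodes, f i ≤ 0)
    (hf : ∀ i ∉ G.basicNodes, ∑ j, G.a i j * (f i - f j) ≤ 0) (i : Fin N) : f i ≤ 0 := by
  have : Nonempty (Fin N) := ⟨i⟩
  obtain ⟨m, hm⟩ := Finite.exists_max f
  refine (hm i).trans (not_lt.1 fun hpos => ?_)
  have key : ∀ v, Relation.ReflTransGen G.Edge v m → f v = f m := by
    intro v hv
    induction hv using Relation.ReflTransGen.head_induction_on with
    | refl => rfl
    | @head u v huv _ ih =>
      have hvb : v ∉ G.basicNodes := fun h => absurd (hb v h) (by rw [ih]; exact not_le.2 hpos)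
      have hnn : ∀ j ∈ Finset.univ, 0 ≤ G.a v j * (f v - f j) := fun j _ =>
        mul_nonneg (G.nonneg v j) (by rw [ih]; linarith [hm j])
      have h0 := (Finset.sum_eq_zero_iff_of_nonneg hnn).1
        (le_antisymm (hf v hvb) (Finset.sum_nonneg hnn)) u (Finset.mem_univ u)
      rcases mul_eq_zero.1 h0 with h | h
      · exact absurd h (ne_of_gt huv)
      · linarith
  obtain ⟨b, hbb, hbm⟩ := G.exists_basic_reach m
  exact absurd (hb b hbb) (by rw [key b hbm]; exact not_le.2 hpos)

theorem sum_laplacian_smul {E : Type*} [AddCommGroup E] [Module ℝ E] (z : Fin N → E) (i : Fin N) :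
    ∑ j, G.laplacian i j • z j = ∑ j, G.a i j • (z i - z j) := by
  have h : ∀ j, G.laplacian i j • z j
      = (if i = j then (∑ k, G.a i k) • z j else 0) - G.a i j • z j := by
    intro j
    by_cases hij : i = j
    · subst hij
      simp [laplacian, G.no_loop]
    · simp [laplacian, hij]
  simp_rw [h, smul_sub, Finset.sum_sub_distrib]
  simp [Finset.sum_smul]

/-- A function on the nodes outside the basic bicomponents, extended by zero. -/
def extendZero (f : G.NonBasic → ℝ) (i : Fin N) : ℝ :=
  if h : i ∈ G.basicNodes then 0 else f ⟨i, h⟩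

theorem L0_mulVec (f : G.NonBasic → ℝ) (j : G.NonBasic) :
    G.L0.mulVec f j = ∑ k : Fin N, G.laplacian j k * G.extendZero f k := by
  classical
  rw [← Fintype.sum_subtype_add_sum_subtype (fun k => k ∈ G.basicNodes)]
  have h1 : ∀ k : {k // k ∈ G.basicNodes}, G.laplacian j k * G.extendZero f k = 0 := by
    intro k
    simp [extendZero, k.2]
  have h2 : ∀ k : G.NonBasic, G.extendZero f k = f k := by
    intro k
    simp [extendZero, k.2]
  simp only [h1, Finset.sum_const_zero, zero_add]
  have h3 : G.L0.mulVec f j = ∑ k : G.NonBasic, G.laplacian j k * f k := rfl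
  simp_rw [h3, ← h2]

theorem isUnit_L0_det : IsUnit G.L0.det := by
  classical
  rw [isUnit_iff_ne_zero]
  intro hdet
  obtain ⟨f, hf0, hf⟩ := Matrix.exists_mulVec_eq_zero_iff.2 hdet
  have hrow : ∀ i ∉ G.basicNodes,
      ∑ j, G.a i j * (G.extendZero f i - G.extendZero f j) = 0 := by
    intro i hi
    have h := G.L0_mulVec f ⟨i, hi⟩
    rw [hf] at h
    exact (G.sum_laplacian_smul (G.extendZero f) i).symm.trans h.symm
  have hzero : ∀ i ∈ G.basicNodes, G.extendZero f i = 0 := by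
    intro i hi
    simp [extendZero, hi]
  refine hf0 (funext fun j => ?_)
  have hle := G.maximum_principle (f := G.extendZero f) (fun i hi => (hzero i hi).le)
    (fun i hi => (hrow i hi).le) j
  have hge := G.maximum_principle (f := fun i => -G.extendZero f i)
    (fun i hi => by simp [hzero i hi])
    (fun i hi => by
      have h := hrow i hi
      rw [← neg_eq_zero, ← Finset.sum_neg_distrib] at h
      exact (Eq.trans (Finset.sum_congr rfl fun j _ => by ring) h).le) j
  have hval : G.extendZero f j = f j := by
    simp [extendZero, j.2]
  rw [hval] at hle
  simp only [hval] at hge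
  exact le_antisymm hle (neg_nonpos.1 hge)

open Classical in
/-- The coefficients `β_{·,K}`, extended to the nodes of the basic bicomponents by the indicator
function of `K`. -/
def betaExt (K : Finset (Fin N)) (i : Fin N) : ℝ :=
  if h : i ∈ G.basicNodes then (if i ∈ K then 1 else 0) else G.beta K ⟨i, h⟩

variable {G}

theorem IsBasicBicomponent.mem_basicNodes {K : Finset (Fin N)} (hK : G.IsBasicBicomponent K)
    {i : Fin N} (hi : i ∈ K) : i ∈ G.basicNodes :=
  G.mem_basicNodes.2 ⟨K, G.mem_basicBicomponents.2 hK, hi⟩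

/-- The extended coefficients are in the kernel of the Laplacian. -/
theorem IsBasicBicomponent.sum_betaExt {K : Finset (Fin N)} (hK : G.IsBasicBicomponent K)
    (i : Fin N) : ∑ j, G.a i j * (G.betaExt K i - G.betaExt K j) = 0 := by
  classical
  by_cases hi : i ∈ G.basicNodes
  · obtain ⟨K', hK', hiK'⟩ := G.mem_basicNodes.1 hi
    rw [G.mem_basicBicomponents] at hK'
    refine Finset.sum_eq_zero fun j _ => ?_
    by_cases hj : j ∈ K'
    · have hij : i ∈ K ↔ j ∈ K := by
        constructor
        · intro h
          rwa [hK.eq_of_mem hK' h hiK']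
        · intro h
          rwa [hK.eq_of_mem hK' h hj]
      simp [betaExt, hi, hK'.mem_basicNodes hj, hij]
    · rw [hK'.a_eq_zero hiK' hj, zero_mul]
  · have hsplit : ∀ k, G.betaExt K k = G.extendZero (G.beta K) k + if k ∈ K then 1 else 0 := by
      intro k
      by_cases hk : k ∈ G.basicNodes
      · simp [betaExt, extendZero, hk]
      · have hkK : k ∉ K := fun h => hk (hK.mem_basicNodes h)
        simp [betaExt, extendZero, hk, hkK]
    have hL0 : G.L0.mulVec (G.beta K) = -(G.L0block K).mulVec 1 := by
      rw [beta, Matrix.mulVec_mulVec, Matrix.mul_neg, Matrix.mul_nonsing_inv_cancel_left _ _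
        G.isUnit_L0_det, Matrix.neg_mulVec]
    have h1 := G.L0_mulVec (G.beta K) ⟨i, hi⟩
    have h2 : (G.L0block K).mulVec 1 ⟨i, hi⟩ = ∑ k, G.laplacian i k * if k ∈ K then 1 else 0 := by
      simp only [mul_ite, mul_one, mul_zero, Finset.sum_ite_mem, Finset.univ_inter]
      rw [← Finset.sum_coe_sort]
      simp [Matrix.mulVec, dotProduct, L0block]
    rw [hL0, Pi.neg_apply, h2] at h1
    refine (G.sum_laplacian_smul (G.betaExt K) i).symm.trans ?_
    simp only [smul_eq_mul, hsplit, mul_add, Finset.sum_add_distrib]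
    rw [← h1]
    exact neg_add_cancel _

theorem IsBasicBicomponent.beta_nonneg {K : Finset (Fin N)} (hK : G.IsBasicBicomponent K)
    (j : G.NonBasic) : 0 ≤ G.beta K j := by
  have h := G.maximum_principle (f := fun i => -G.betaExt K i)
    (fun i hi => by
      by_cases hiK : i ∈ K <;> simp [betaExt, hi, hiK])
    (fun i _ => by
      have h := hK.sum_betaExt i
      rw [← neg_eq_zero, ← Finset.sum_neg_distrib] at h
      exact (Eq.trans (Finset.sum_congr rfl fun j _ => by ring) h).le) j
  simpa [betaExt, j.2] using h

theorem sum_betaExt_smul_of_mem {E : Type*} [AddCommGroup E] [Module ℝ E] {K : Finset (Fin N)}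
    (hK : K ∈ G.basicBicomponents) {i : Fin N} (hi : i ∈ K) (w : Finset (Fin N) → E) :
    ∑ K' ∈ G.basicBicomponents, G.betaExt K' i • w K' = w K := by
  have hK0 := G.mem_basicBicomponents.1 hK
  rw [Finset.sum_eq_single_of_mem K hK]
  · simp [betaExt, hK0.mem_basicNodes hi, hi]
  · intro K' hK' hne
    have : i ∉ K' := fun h => hne ((G.mem_basicBicomponents.1 hK').eq_of_mem hK0 h hi)
    simp [betaExt, hK0.mem_basicNodes hi, this]

variable (G)

theorem sum_beta (j : G.NonBasic) : ∑ K ∈ G.basicBicomponents, G.beta K j = 1 := by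
  have hb : ∀ i ∈ G.basicNodes, ∑ K ∈ G.basicBicomponents, G.betaExt K i = 1 := by
    intro i hi
    obtain ⟨K, hK, hiK⟩ := G.mem_basicNodes.1 hi
    simpa using sum_betaExt_smul_of_mem hK hiK (fun _ => (1 : ℝ))
  have hrow : ∀ i, ∑ k, G.a i k * ((∑ K ∈ G.basicBicomponents, G.betaExt K i)
      - ∑ K ∈ G.basicBicomponents, G.betaExt K k) = 0 := by
    intro i
    simp_rw [← Finset.sum_sub_distrib, Finset.mul_sum]
    rw [Finset.sum_comm]
    exact Finset.sum_eq_zero fun K hK => (G.mem_basicBicomponents.1 hK).sum_betaExt i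
  have h1 := G.maximum_principle (f := fun i => (∑ K ∈ G.basicBicomponents, G.betaExt K i) - 1)
    (fun i hi => by simp [hb i hi]) (fun i _ => by simpa using (hrow i).le) j
  have h2 := G.maximum_principle (f := fun i => 1 - ∑ K ∈ G.basicBicomponents, G.betaExt K i)
    (fun i hi => by simp [hb i hi]) (fun i _ => by
      have h := hrow i
      rw [← neg_eq_zero, ← Finset.sum_neg_distrib] at h
      exact (Eq.trans (Finset.sum_congr rfl fun j _ => by ring) h).le) j
  have hval : ∑ K ∈ G.basicBicomponents, G.betaExt K j = ∑ K ∈ G.basicBicomponents, G.beta K j :=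
    Finset.sum_congr rfl fun K _ => by simp [betaExt, j.2]
  simp only [hval] at h1 h2
  linarith

end WDigraph

/-! ### Averages over a basic bicomponent -/

/-- A square matrix with nonpositive off-diagonal entries and zero row sums has a nonnegative left
null vector with entries summing up to one: the absolute value of any left null vector is again
one. -/
theorem Matrix.exists_stochastic_vecMul_eq_zero {ι : Type*} [Fintype ι] [DecidableEq ι] [Nonempty ι]
    (Q : Matrix ι ι ℝ) (hoff : ∀ i j, i ≠ j → Q i j ≤ 0) (hrow : ∀ i, ∑ j, Q i j = 0) :
    ∃ v : ι → ℝ, (∀ i, 0 ≤ v i) ∧ ∑ i, v i = 1 ∧ Matrix.vecMul v Q = 0 := by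
  have hdet : Q.det = 0 := Matrix.exists_mulVec_eq_zero_iff.1
    ⟨1, one_ne_zero, funext fun i => by simpa [Matrix.mulVec, dotProduct] using hrow i⟩
  obtain ⟨v, hv0, hv⟩ := Matrix.exists_vecMul_eq_zero_iff.2 hdet
  -- The entries of `|v| Q` are nonpositive, and they sum up to zero since the row sums of `Q` vanish.
  have hcol : ∀ j, ∑ i, |v i| * Q i j ≤ 0 := by
    intro j
    have hj : ∑ i, v i * Q i j = 0 := congrFun hv j
    rw [← Finset.add_sum_erase _ _ (Finset.mem_univ j)] at hj ⊢
    have hQ : 0 ≤ Q j j := by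
      have h := hrow j
      rw [← Finset.add_sum_erase _ _ (Finset.mem_univ j)] at h
      have := Finset.sum_nonpos fun i (hi : i ∈ Finset.univ.erase j) =>
        hoff j i (Finset.ne_of_mem_erase hi).symm
      linarith
    have h1 : |v j| * Q j j = |∑ i ∈ Finset.univ.erase j, v i * Q i j| := by
      rw [← abs_neg (∑ i ∈ Finset.univ.erase j, v i * Q i j), ← eq_neg_of_add_eq_zero_left hj,
        abs_mul, abs_of_nonneg hQ]
    have h2 : |∑ i ∈ Finset.univ.erase j, v i * Q i j|
        ≤ ∑ i ∈ Finset.univ.erase j, -(|v i| * Q i j) := by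
      refine (Finset.abs_sum_le_sum_abs _ _).trans (Finset.sum_le_sum fun i hi => ?_)
      rw [abs_mul, abs_of_nonpos (hoff i j (Finset.ne_of_mem_erase hi)), mul_neg]
    rw [Finset.sum_neg_distrib] at h2
    linarith
  have htotal : ∑ j, ∑ i, |v i| * Q i j = 0 := by
    rw [Finset.sum_comm]
    simp_rw [← Finset.mul_sum, hrow, mul_zero, Finset.sum_const_zero]
  have hzero := (Finset.sum_eq_zero_iff_of_nonpos fun j _ => hcol j).1 htotal
  have hpos : 0 < ∑ i, |v i| := by
    obtain ⟨i, hi⟩ := Function.ne_iff.1 hv0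
    exact Finset.sum_pos' (fun _ _ => abs_nonneg _) ⟨i, Finset.mem_univ i, abs_pos.2 hi⟩
  refine ⟨fun i => (∑ i, |v i|)⁻¹ * |v i|, fun i => by positivity, ?_, ?_⟩
  · rw [← Finset.mul_sum, inv_mul_cancel₀ hpos.ne']
  · ext j
    change ∑ i, (∑ i, |v i|)⁻¹ * |v i| * Q i j = 0
    simp_rw [mul_assoc]
    rw [← Finset.mul_sum, hzero j (Finset.mem_univ j), mul_zero]

namespace WDigraph

variable {N : ℕ} {G : WDigraph N}

/-- `α` is a probability vector that is supported on `K` and a left null vector of the Laplacian,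
so that the coupling of the nodes cancels in the average with the weights `α`. -/
structure IsAveraging (G : WDigraph N) (K : Finset (Fin N)) (α : Fin N → ℝ) : Prop where
  nonneg : ∀ i, 0 ≤ α i
  eq_zero : ∀ i, i ∉ K → α i = 0
  sum_eq_one : ∑ i, α i = 1
  vecMul_eq_zero : Matrix.vecMul α G.laplacian = 0

theorem IsBasicBicomponent.exists_isAveraging {K : Finset (Fin N)}
    (hK : G.IsBasicBicomponent K) : ∃ α, G.IsAveraging K α := by
  classical
  obtain ⟨i₀, hi₀⟩ := hK.1.prop.1
  have : Nonempty K := ⟨⟨i₀, hi₀⟩⟩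
  have hLout : ∀ i ∈ K, ∀ j ∉ K, G.laplacian i j = 0 := by
    intro i hi j hj
    have hij : i ≠ j := fun h => hj (h ▸ hi)
    simp [laplacian, hij, hK.a_eq_zero hi hj]
  have hsumK : ∀ f : Fin N → ℝ, (∀ i ∉ K, f i = 0) → ∑ i, f i = ∑ i : K, f i := by
    intro f hf
    rw [Finset.sum_coe_sort K f]
    exact (Finset.sum_subset (Finset.subset_univ K) fun i _ hi => hf i hi).symm
  obtain ⟨v, hv, hv1, hvL⟩ := (G.Lblock K).exists_stochastic_vecMul_eq_zero
    (fun i j hij => by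
      have : (i : Fin N) ≠ j := fun h => hij (Subtype.ext h)
      simp [Lblock, laplacian, this, G.nonneg])
    (fun i => by
      have h := G.sum_laplacian_smul (fun _ => (1 : ℝ)) i
      simp only [smul_eq_mul, mul_one, sub_self, mul_zero, Finset.sum_const_zero] at h
      rw [hsumK _ (hLout i i.2)] at h
      exact h)
  have hα : ∀ i : K, (if h : (i : Fin N) ∈ K then v ⟨i, h⟩ else 0) = v i := by
    intro i
    simp
  refine ⟨fun i => if h : i ∈ K then v ⟨i, h⟩ else 0, ?_, ?_, ?_, ?_⟩
  · intro i
    split_ifs with h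
    exacts [hv _, le_rfl]
  · intro i hi
    simp [hi]
  · rw [hsumK _ fun i hi => by simp [hi]]
    simpa only [hα] using hv1
  · ext j
    change ∑ i, (if h : i ∈ K then v ⟨i, h⟩ else 0) * G.laplacian i j = 0
    rw [hsumK _ fun i hi => by simp [hi]]
    simp only [hα]
    by_cases hj : j ∈ K
    · exact congrFun hvL ⟨j, hj⟩
    · exact Finset.sum_eq_zero fun i _ => by rw [hLout i i.2 j hj, mul_zero]

theorem IsAveraging.sum_coe {K : Finset (Fin N)} {α : Fin N → ℝ}
    (hα : G.IsAveraging K α) {E : Type*} [AddCommGroup E] [Module ℝ E] (w : Fin N → E) :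
    ∑ l : K, α l • w l = ∑ l, α l • w l := by
  rw [Finset.sum_coe_sort K fun l => α l • w l]
  exact Finset.sum_subset (Finset.subset_univ K) fun l _ hl => by rw [hα.eq_zero l hl, zero_smul]

theorem IsAveraging.sum_smul {K : Finset (Fin N)} {α : Fin N → ℝ} (hα : G.IsAveraging K α)
    {E : Type*} [AddCommGroup E] [Module ℝ E] (z : Fin N → E) :
    ∑ i, α i • ∑ j, G.a i j • (z i - z j) = 0 := by
  simp_rw [← G.sum_laplacian_smul z, Finset.smul_sum, smul_smul]
  rw [Finset.sum_comm]
  simp_rw [← Finset.sum_smul]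
  refine Finset.sum_eq_zero fun j _ => ?_
  have : ∑ i, α i * G.laplacian i j = 0 := congrFun hα.vecMul_eq_zero j
  rw [this, zero_smul]

/-! ### Rewiring a graph to a single basic bicomponent -/

open Classical in
/-- The graph in which the incoming edges of the nodes of all the basic bicomponents other than `K`
are replaced by edges from the nodes of `K` with the weights `α`. A node with these edges can stay at
rest if the average over `K` vanishes. -/
def rewire (G : WDigraph N) {K : Finset (Fin N)} {α : Fin N → ℝ} (hα : G.IsAveraging K α) :
    WDigraph N where
  a i j := if i ∈ G.basicNodes ∧ i ∉ K then α j else G.a i j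
  nonneg i j := by
    split_ifs
    exacts [hα.nonneg j, G.nonneg i j]
  no_loop i := by
    split_ifs with h
    exacts [hα.eq_zero i h.2, G.no_loop i]

theorem rewire_a_of_mem {K : Finset (Fin N)} {α : Fin N → ℝ} (hα : G.IsAveraging K α)
    {i : Fin N} (hi : i ∈ K) : (G.rewire hα).a i = G.a i := by
  ext j
  simp [rewire, hi]

theorem rewire_a_of_notMem {K : Finset (Fin N)} {α : Fin N → ℝ} (hα : G.IsAveraging K α)
    {i : Fin N} (hi : i ∉ G.basicNodes) : (G.rewire hα).a i = G.a i := by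
  ext j
  simp [rewire, hi]

theorem rewire_a_of_mem_of_notMem {K : Finset (Fin N)} {α : Fin N → ℝ} (hα : G.IsAveraging K α)
    {i : Fin N} (hi : i ∈ G.basicNodes) (hiK : i ∉ K) : (G.rewire hα).a i = α := by
  ext j
  simp [rewire, hi, hiK]

theorem IsBasicBicomponent.rewire_hasDirectedSpanningTree {K : Finset (Fin N)} {α : Fin N → ℝ}
    (hK : G.IsBasicBicomponent K) (hα : G.IsAveraging K α) :
    (G.rewire hα).HasDirectedSpanningTree := by
  obtain ⟨r, hr⟩ := hK.1.prop.1
  have hKr : ∀ v ∈ K, Relation.ReflTransGen (G.rewire hα).Edge r v := by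
    intro v hv
    refine Relation.ReflTransGen.mono (fun p q h => ?_) _ _ (hK.1.prop.2 r hr v hv)
    rw [Edge, rewire_a_of_mem hα h.2.1]
    exact h.2.2
  have hbr : ∀ v ∈ G.basicNodes, Relation.ReflTransGen (G.rewire hα).Edge r v := by
    intro v hv
    by_cases hvK : v ∈ K
    · exact hKr v hvK
    · obtain ⟨l, -, hl⟩ : ∃ l ∈ Finset.univ, 0 < α l := by
        by_contra! h
        have := Finset.sum_nonpos h
        rw [hα.sum_eq_one] at this
        linarith
      have hlK : l ∈ K := by
        by_contra h
        exact hl.ne' (hα.eq_zero l h)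
      refine (hKr l hlK).tail ?_
      rw [Edge, rewire_a_of_mem_of_notMem hα hv hvK]
      exact hl
  refine (G.rewire hα).hasDirectedSpanningTree_of_root r fun v => ?_
  obtain ⟨b, hb, hbv⟩ := G.exists_basic_reach v
  induction hbv with
  | refl => exact hbr b hb
  | @tail p q _ hpq ih =>
    by_cases hq : q ∈ G.basicNodes
    · exact hbr q hq
    · refine ih.tail ?_
      rw [Edge, rewire_a_of_notMem hα hq]
      exact hpq

end WDigraph

/-! ### Linear differential equations and detectability -/

section LinearODE

/-- Variation of constants: a linear ODE with a continuous forcing term has a solution. -/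
theorem exists_hasDerivAt_affine {W : Type*} [NormedAddCommGroup W] [NormedSpace ℝ W]
    [CompleteSpace W] (F : W →L[ℝ] W) {f : ℝ → W} (hf : Continuous f) :
    ∃ v : ℝ → W, ∀ t, HasDerivAt v (F (v t) + f t) t := by
  have hexp : ∀ t : ℝ, HasDerivAt (fun s : ℝ => NormedSpace.exp (s • F))
      (F * NormedSpace.exp (t • F)) t := fun t => hasDerivAt_exp_smul_const' F t
  have hcont : Continuous fun s : ℝ => NormedSpace.exp ((-s) • F) (f s) := by
    refine Continuous.clm_apply ?_ hf
    exact (continuous_iff_continuousAt.2 fun t => (hexp t).continuousAt).comp continuous_neg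
  refine ⟨fun t => NormedSpace.exp (t • F) (∫ s in (0 : ℝ)..t, NormedSpace.exp ((-s) • F) (f s)),
    fun t => ?_⟩
  have h := (hexp t).clm_apply (intervalIntegral.integral_hasDerivAt_right
    (hcont.intervalIntegrable 0 t) (hcont.stronglyMeasurableAtFilter _ _) hcont.continuousAt)
  convert h using 1
  let _ : NormedAlgebra ℚ (W →L[ℝ] W) := .restrictScalars ℚ ℝ _
  have hinv : NormedSpace.exp (t • F) * NormedSpace.exp ((-t) • F) = 1 := by
    rw [← NormedSpace.exp_add_of_commute (by
      exact ((Commute.refl F).smul_left t).smul_right (-t)), ← add_smul, add_neg_cancel, zero_smul,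
      NormedSpace.exp_zero]
  rw [← mul_apply_eq_comp (NormedSpace.exp (t • F)), hinv]
  rfl

variable {W : Type*} [NormedAddCommGroup W] [NormedSpace ℂ W]

theorem hasDerivAt_exp_ofReal_smul_apply [CompleteSpace W] [NormedSpace ℝ W] [IsScalarTower ℝ ℂ W]
    (A : W →L[ℂ] W) (v : W) (t : ℝ) :
    HasDerivAt (fun s : ℝ => NormedSpace.exp ((s : ℂ) • A) v)
      (A (NormedSpace.exp ((t : ℂ) • A) v)) t := by
  have h := (hasDerivAt_exp_smul_const' A (t : ℂ)).clm_apply (hasDerivAt_const (t : ℂ) v)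
  simpa [Function.comp_def] using h.scomp t Complex.ofRealCLM.hasDerivAt

theorem eq_exp_of_hasDerivAt [CompleteSpace W] [NormedSpace ℝ W] [IsScalarTower ℝ ℂ W]
    (A : W →L[ℂ] W) {z : ℝ → W} (hz : ∀ t, HasDerivAt z (A (z t)) t) (t : ℝ) :
    z t = NormedSpace.exp ((t : ℂ) • A) (z 0) := by
  have h := ODE_solution_unique_univ (v := fun _ => A) (s := fun _ => Set.univ) (t₀ := 0)
    (fun _ => A.lipschitz.lipschitzOnWith) (fun t => ⟨hz t, Set.mem_univ _⟩)
    (fun t => ⟨hasDerivAt_exp_ofReal_smul_apply A (z 0) t, Set.mem_univ _⟩) (by simp)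
  exact congrFun h t

theorem exp_add_smul_apply [CompleteSpace W] (A : W →L[ℂ] W) (s t : ℂ) (v : W) :
    NormedSpace.exp ((s + t) • A) v = NormedSpace.exp (s • A) (NormedSpace.exp (t • A) v) := by
  let _ : NormedAlgebra ℚ (W →L[ℂ] W) := .restrictScalars ℚ ℂ _
  rw [add_smul, NormedSpace.exp_add_of_commute (((Commute.refl A).smul_left s).smul_right t)]
  rfl

/-- On a generalized eigenvector the exponential is a scalar exponential times a polynomial. -/
theorem exp_smul_apply_of_mem_genEigenspace [CompleteSpace W] (A : W →L[ℂ] W) (μ : ℂ) (k : ℕ) (v : W)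
    (hv : ((A - μ • (1 : W →L[ℂ] W)) ^ k) v = 0) (t : ℝ) :
    NormedSpace.exp ((t : ℂ) • A) v = Complex.exp (t * μ) •
      ∑ j ∈ Finset.range k, ((j.factorial : ℂ)⁻¹ * (t : ℂ) ^ j) • ((A - μ • (1 : W →L[ℂ] W)) ^ j) v := by
  set B := A - μ • (1 : W →L[ℂ] W) with hB
  have hA : (t : ℂ) • A = ((t : ℂ) * μ) • (1 : W →L[ℂ] W) + (t : ℂ) • B := by
    rw [hB, smul_sub, smul_smul]; abel
  have hscal : NormedSpace.exp (((t : ℂ) * μ) • (1 : W →L[ℂ] W))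
      = Complex.exp (t * μ) • (1 : W →L[ℂ] W) := by
    have := NormedSpace.algebraMap_exp_comm (𝔸 := W →L[ℂ] W) ((t : ℂ) * μ)
    rw [Algebra.algebraMap_eq_smul_one, Algebra.algebraMap_eq_smul_one] at this
    rw [← this, Complex.exp_eq_exp_ℂ]
  let _ : NormedAlgebra ℚ (W →L[ℂ] W) := .restrictScalars ℚ ℂ _
  rw [hA, NormedSpace.exp_add_of_commute ((Commute.one_left _).smul_left _), hscal]
  rw [smul_mul_assoc, one_mul, smul_apply]
  congr 1
  have hs := NormedSpace.exp_series_hasSum_exp' (𝕂 := ℂ) ((t : ℂ) • B)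
  have hs' := ((ContinuousLinearMap.apply ℂ W v).hasSum hs)
  refine hs'.unique ?_
  have hterm : ∀ j : ℕ, (ContinuousLinearMap.apply ℂ W v) ((j.factorial : ℂ)⁻¹ • ((t : ℂ) • B) ^ j)
      = ((j.factorial : ℂ)⁻¹ * (t : ℂ) ^ j) • (B ^ j) v := by
    intro j
    rw [smul_pow, smul_smul]
    rfl
  simp_rw [hterm]
  refine hasSum_sum_of_ne_finset_zero fun j hj => ?_
  obtain ⟨l, rfl⟩ := Nat.exists_eq_add_of_le (not_lt.1 fun h => hj (Finset.mem_range.2 h))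
  have hvl : (B ^ (k + l)) v = 0 := by
    rw [add_comm, pow_add, mul_apply_eq_comp, hv, map_zero]
  rw [hvl, smul_zero]

theorem tendsto_exp_smul_apply_of_re_neg [CompleteSpace W] (A : W →L[ℂ] W) {μ : ℂ} (hμ : μ.re < 0) (k : ℕ)
    (v : W) (hv : ((A - μ • (1 : W →L[ℂ] W)) ^ k) v = 0) :
    Tendsto (fun t : ℝ => NormedSpace.exp ((t : ℂ) • A) v) atTop (𝓝 0) := by
  simp_rw [exp_smul_apply_of_mem_genEigenspace A μ k v hv, Finset.smul_sum, smul_smul]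
  rw [← Finset.sum_const_zero (s := Finset.range k)]
  refine tendsto_finsetSum _ fun j _ => ?_
  rw [← zero_smul ℂ (((A - μ • (1 : W →L[ℂ] W)) ^ j) v)]
  refine Tendsto.smul_const ?_ _
  rw [tendsto_zero_iff_norm_tendsto_zero]
  have h := ((isLittleO_pow_exp_pos_mul_atTop j (neg_pos.2 hμ)).tendsto_div_nhds_zero).const_mul
    ((j.factorial : ℝ)⁻¹)
  rw [mul_zero] at h
  refine h.congr' ?_
  filter_upwards [eventually_ge_atTop 0] with t ht
  rw [norm_mul, norm_mul, Complex.norm_exp, norm_inv, norm_pow, Complex.norm_natCast,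
    Complex.norm_real, Real.norm_of_nonneg ht, Complex.re_ofReal_mul, neg_mul, Real.exp_neg,
    div_inv_eq_mul, mul_comm μ.re t]
  ring

/-- The subspace of the initial states for which the output `E z` of `z' = A z` tends to zero. -/
def vanishingOutput {Y : Type*} [NormedAddCommGroup Y] [NormedSpace ℂ Y]
    (A : W →L[ℂ] W) (E : W →L[ℂ] Y) : Submodule ℂ W where
  carrier := {v | Tendsto (fun t : ℝ => E (NormedSpace.exp ((t : ℂ) • A) v)) atTop (𝓝 0)}
  zero_mem' := by simp
  add_mem' hv hw := by simpa using hv.add hw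
  smul_mem' c v hv := by simpa using hv.const_smul c

/-- The subspace is invariant, because it is closed and contains all the states of a trajectory
that starts in it, hence also the derivative of the trajectory. -/
theorem map_mem_vanishingOutput [FiniteDimensional ℂ W] {Y : Type*} [NormedAddCommGroup Y]
    [NormedSpace ℂ Y] (A : W →L[ℂ] W) (E : W →L[ℂ] Y) {v : W}
    (hv : v ∈ vanishingOutput A E) : A v ∈ vanishingOutput A E := by
  have : CompleteSpace W := FiniteDimensional.complete ℂ W
  let _ : NormedSpace ℝ W := NormedSpace.restrictScalars ℝ ℂ W
  have _ : IsScalarTower ℝ ℂ W := RestrictScalars.isScalarTower ℝ ℂ W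
  let g : ℝ → W := fun s => NormedSpace.exp ((s : ℂ) • A) v
  have hg : deriv g 0 = A v :=
    (hasDerivAt_exp_ofReal_smul_apply A v 0).deriv.trans (by simp)
  have hmem : ∀ s, g s ∈ (vanishingOutput A E).restrictScalars ℝ := by
    intro s
    have h := Tendsto.comp (f := fun t : ℝ => t + s) hv (tendsto_atTop_add_const_right _ s tendsto_id)
    refine h.congr fun t => ?_
    simp only [Function.comp_apply, Complex.ofReal_add, exp_add_smul_apply, g]
  have hspan : Submodule.span ℝ (g '' Set.univ) ≤ (vanishingOutput A E).restrictScalars ℝ := by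
    rw [Submodule.span_le]
    rintro _ ⟨s, -, rfl⟩
    exact hmem s
  have hcl : IsClosed ((vanishingOutput A E : Submodule ℂ W) : Set W) :=
    Submodule.closed_of_finiteDimensional _
  have h := range_deriv_subset_closure_span_image g dense_univ (Set.mem_range_self 0)
  rw [hg] at h
  exact closure_minimal (t := ((vanishingOutput A E : Submodule ℂ W) : Set W)) hspan hcl h

/-- An output `E z` of `z' = A z` that tends to zero forces the state `z` to tend to zero, if no
eigenvector of `A` for an eigenvalue in the closed right half plane is in the kernel of `E`: the
generalized eigenspaces for these eigenvalues meet the invariant subspace `vanishingOutput A E`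
trivially, and the others consist of initial states of decaying trajectories. -/
theorem tendsto_zero_of_output_tendsto_zero [FiniteDimensional ℂ W] [NormedSpace ℝ W]
    [IsScalarTower ℝ ℂ W] {Y : Type*} [NormedAddCommGroup Y] [NormedSpace ℂ Y]
    (A : W →L[ℂ] W) (E : W →L[ℂ] Y)
    (hdet : ∀ (μ : ℂ) (v : W), 0 ≤ μ.re → A v = μ • v → E v = 0 → v = 0)
    {z : ℝ → W} (hz : ∀ t, HasDerivAt z (A (z t)) t)
    (hEz : Tendsto (fun t => E (z t)) atTop (𝓝 0)) : Tendsto z atTop (𝓝 0) := by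
  have : CompleteSpace W := FiniteDimensional.complete ℂ W
  have hzexp := eq_exp_of_hasDerivAt A hz
  have hz0 : z 0 ∈ vanishingOutput A E := hEz.congr fun t => by rw [hzexp t]
  have hunst : ∀ μ : ℂ, 0 ≤ μ.re → ∀ k : ℕ, ∀ v ∈ vanishingOutput A E,
      ((A - μ • (1 : W →L[ℂ] W)) ^ k) v = 0 → v = 0 := by
    intro μ hμ k
    induction k with
    | zero => intro v _ hv; simpa using hv
    | succ k ih =>
      intro v hvV hv
      have hw : (A - μ • (1 : W →L[ℂ] W)) v = 0 := by
        refine ih _ ?_ ?_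
        · exact Submodule.sub_mem _ (map_mem_vanishingOutput A E hvV) (Submodule.smul_mem _ _ hvV)
        · rw [pow_succ, mul_apply_eq_comp] at hv
          exact hv
      -- `v` is an eigenvector, and its output `exp (t μ) • E v` tends to zero although `|exp (t μ)| ≥ 1`.
      refine hdet μ v hμ (sub_eq_zero.1 hw) ?_
      have hexp : ∀ t : ℝ, E (NormedSpace.exp ((t : ℂ) • A) v) = Complex.exp (t * μ) • E v := by
        intro t
        rw [exp_smul_apply_of_mem_genEigenspace A μ 1 v (by simpa using hw)]
        simp
      have hlim : Tendsto (fun t : ℝ => E (NormedSpace.exp ((t : ℂ) • A) v)) atTop (𝓝 0) := hvV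
      simp_rw [hexp] at hlim
      rw [← norm_le_zero_iff]
      refine ge_of_tendsto (b := ‖E v‖) (by simpa using hlim.norm) ?_
      filter_upwards [eventually_ge_atTop 0] with t ht
      rw [norm_smul, Complex.norm_exp, Complex.re_ofReal_mul]
      exact le_mul_of_one_le_left (norm_nonneg _) (Real.one_le_exp (mul_nonneg ht hμ))
  have hpow : ∀ (μ : ℂ) (k : ℕ) (v : W), (((A : Module.End ℂ W) - μ • 1) ^ k) v
      = ((A - μ • (1 : W →L[ℂ] W)) ^ k) v := by
    intro μ k
    induction k with
    | zero => intro v; rfl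
    | succ k ih => 
      intro v
      rw [pow_succ, pow_succ]
      exact ih _
  have hsup : z 0 ∈ ⨆ μ, vanishingOutput A E ⊓ Module.End.genEigenspace (A : Module.End ℂ W) μ ⊤ := by
    rw [← Submodule.inf_iSup_genEigenspace fun x hx => map_mem_vanishingOutput A E hx]
    refine ⟨hz0, ?_⟩
    have h := Module.End.iSup_maxGenEigenspace_eq_top (A : Module.End ℂ W)
    exact h.symm ▸ Submodule.mem_top
  suffices h : Tendsto (fun t : ℝ => NormedSpace.exp ((t : ℂ) • A) (z 0)) atTop (𝓝 0) from
    h.congr fun t => (hzexp t).symm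
  generalize z 0 = v₀ at hsup
  induction hsup using Submodule.iSup_induction' with
  | mem μ v hv =>
    obtain ⟨hvV, hvμ⟩ := hv
    obtain ⟨k, -, hk⟩ := Module.End.mem_genEigenspace.1 hvμ
    have hk' := (hpow μ k v).symm.trans hk
    by_cases hμ : 0 ≤ μ.re
    · simp [hunst μ hμ k v hvV hk']
    · exact tendsto_exp_smul_apply_of_re_neg A (not_le.1 hμ) k v hk'
  | zero => simp
  | add v w _ _ hv hw => simpa using hv.add hw

end LinearODE

/-! ### Networks of identical linear systems -/

namespace WDigraph

variable {N : ℕ} {E : Type*} [NormedAddCommGroup E] [NormedSpace ℝ E]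

/-- The state `z i` of the node `i` of `G` satisfies its equation in the network of identical
systems with the drift `T` and the coupling `M`. -/
def SolvesNode (G : WDigraph N) (T M : E →L[ℝ] E) (z : Fin N → ℝ → E) (i : Fin N) : Prop :=
  ∀ t, HasDerivAt (z i) (T (z i t) + M (∑ j, G.a i j • (z i t - z j t))) t

variable {G : WDigraph N} {T M : E →L[ℝ] E}

theorem SolvesNode.sub {z w : Fin N → ℝ → E} {i : Fin N} (hz : G.SolvesNode T M z i)
    (hw : G.SolvesNode T M w i) : G.SolvesNode T M (fun j t => z j t - w j t) i := by
  intro t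
  refine ((hz t).sub (hw t)).congr_deriv ?_
  have h : ∀ j, G.a i j • (z i t - w i t - (z j t - w j t))
      = G.a i j • (z i t - z j t) - G.a i j • (w i t - w j t) := by
    intro j
    rw [← smul_sub]
    congr 1
    abel
  simp only [h, Finset.sum_sub_distrib, map_sub]
  abel

theorem SolvesNode.sum {ι : Type*} {s : Finset ι} {z : ι → Fin N → ℝ → E} {i : Fin N}
    (hz : ∀ k ∈ s, G.SolvesNode T M (z k) i) :
    G.SolvesNode T M (fun j t => ∑ k ∈ s, z k j t) i := by
  intro t
  refine (HasDerivAt.fun_sum fun k hk => hz k hk t).congr_deriv ?_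
  have h : ∀ j, G.a i j • (∑ k ∈ s, z k i t - ∑ k ∈ s, z k j t)
      = ∑ k ∈ s, G.a i j • (z k i t - z k j t) := by
    intro j
    rw [← Finset.sum_sub_distrib, Finset.smul_sum]
  simp_rw [h]
  rw [Finset.sum_comm]
  simp only [map_sum, Finset.sum_add_distrib]

/-- Multiples of a solution of `w' = T w` solve the network equations as long as their factors are
balanced at each node. -/
theorem solvesNode_smul {w : ℝ → E} (hw : ∀ t, HasDerivAt w (T (w t)) t) {f : Fin N → ℝ}
    {i : Fin N} (hf : ∑ j, G.a i j * (f i - f j) = 0) :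
    G.SolvesNode T M (fun j t => f j • w t) i := by
  intro t
  refine ((hw t).const_smul (f i)).congr_deriv ?_
  simp_rw [← sub_smul, smul_smul]
  rw [← Finset.sum_smul, hf]
  simp

/-- The coupling does not affect the weighted average over a basic bicomponent. -/
theorem IsAveraging.hasDerivAt {K : Finset (Fin N)} {α : Fin N → ℝ} (hα : G.IsAveraging K α)
    {z : Fin N → ℝ → E} (hz : ∀ i, G.SolvesNode T M z i) (t : ℝ) :
    HasDerivAt (fun t => ∑ i, α i • z i t) (T (∑ i, α i • z i t)) t := by
  refine (HasDerivAt.fun_sum fun i (_ : i ∈ Finset.univ) =>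
    (hz i t).const_smul (α i)).congr_deriv ?_
  simp only [smul_add, ← map_smul, Finset.sum_add_distrib, ← map_sum, hα.sum_smul, map_zero,
    add_zero]

/-- The trajectories of the nodes in `D` can be prescribed. -/
theorem exists_solvesNode [CompleteSpace E] (G : WDigraph N) (T M : E →L[ℝ] E) (D : Finset (Fin N))
    {g : Fin N → ℝ → E} (hg : ∀ i ∈ D, Continuous (g i)) :
    ∃ u : Fin N → ℝ → E, (∀ i ∈ D, u i = g i) ∧ ∀ i ∉ D, G.SolvesNode T M u i := by
  classical
  let π : Fin N → (Fin N → E) →L[ℝ] E := ContinuousLinearMap.proj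
  let F : (Fin N → E) →L[ℝ] (Fin N → E) := ContinuousLinearMap.pi fun i =>
    T.comp (π i) + M.comp (∑ j, G.a i j • (π i - if j ∈ D then 0 else π j))
  let f : ℝ → Fin N → E := fun t i => M (∑ j, G.a i j • -(if j ∈ D then g j t else 0))
  have hf : Continuous f := by
    refine continuous_pi fun i => M.continuous.comp (continuous_finsetSum _ fun j _ => ?_)
    refine Continuous.const_smul (Continuous.neg ?_) _
    by_cases hj : j ∈ D
    · simpa [hj] using hg j hj
    · simpa [hj] using continuous_const
  obtain ⟨v, hv⟩ := exists_hasDerivAt_affine F hf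
  refine ⟨fun i => if i ∈ D then g i else fun t => v t i, fun i hi => by simp [hi], ?_⟩
  intro i hi t
  have h := hasDerivAt_pi.1 (hv t) i
  simp only [hi, if_false]
  convert h using 1
  simp only [F, f, π, Pi.add_apply, ContinuousLinearMap.coe_pi', add_apply,
    ContinuousLinearMap.comp_apply, ContinuousLinearMap.proj_apply, add_assoc]
  rw [← map_add, sum_apply, ← Finset.sum_add_distrib]
  congr 2
  refine Finset.sum_congr rfl fun j _ => ?_
  by_cases hj : j ∈ D
  · simp [hj, sub_eq_add_neg]
  · simp [hj]

variable {F : Type*} [NormedAddCommGroup F] [NormedSpace ℝ F]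

/-- In every network on `N` nodes whose graph contains a directed spanning tree, the outputs `Q z`
of any two nodes synchronize. -/
def Synchronizes (N : ℕ) (T M : E →L[ℝ] E) (Q : E →L[ℝ] F) : Prop :=
  ∀ G : WDigraph N, G.HasDirectedSpanningTree → ∀ z : Fin N → ℝ → E,
    (∀ i, G.SolvesNode T M z i) → ∀ i j, Tendsto (fun t => Q (z i t - z j t)) atTop (𝓝 0)

/-- If all the basic nodes outside `K` are at rest and the average over `K` vanishes, then `u` is
also a trajectory of the rewired graph, which contains a directed spanning tree. Hence the outputs
of all the nodes tend to the output of a node at rest. -/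
theorem tendsto_zero_of_average_eq_zero {Q : E →L[ℝ] F} (hsync : Synchronizes N T M Q)
    {K : Finset (Fin N)} (hK : G.IsBasicBicomponent K) {α : Fin N → ℝ} (hα : G.IsAveraging K α)
    {l : Fin N} (hl : l ∈ G.basicNodes) (hlK : l ∉ K) {u : Fin N → ℝ → E}
    (hout : ∀ i ∈ G.basicNodes, i ∉ K → ∀ t, u i t = 0) (hin : ∀ i ∈ K, G.SolvesNode T M u i)
    (hnon : ∀ i ∉ G.basicNodes, G.SolvesNode T M u i) (havg : ∀ t, ∑ i, α i • u i t = 0)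
    (i : Fin N) : Tendsto (fun t => Q (u i t)) atTop (𝓝 0) := by
  have hu : ∀ i, (G.rewire hα).SolvesNode T M u i := by
    intro i t
    by_cases hiK : i ∈ K
    · simpa only [rewire_a_of_mem hα hiK] using hin i hiK t
    by_cases hi : i ∈ G.basicNodes
    · have hui : u i = fun _ => 0 := funext (hout i hi hiK)
      rw [rewire_a_of_mem_of_notMem hα hi hiK, hui]
      simp only [zero_sub, smul_neg, Finset.sum_neg_distrib, havg, neg_zero, map_zero, add_zero]
      exact hasDerivAt_const t 0
    · simpa only [rewire_a_of_notMem hα hi] using hnon i hi t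
  simpa only [hout l hl hlK, sub_zero] using
    hsync _ (hK.rewire_hasDirectedSpanningTree hα) u hu i l

/-- Synchronization on graphs with a directed spanning tree gives convergence to zero on a graph
without one, for trajectories whose average over each basic bicomponent vanishes. -/
theorem tendsto_zero_of_forall_average_eq_zero [CompleteSpace E] {Q : E →L[ℝ] F}
    (hsync : Synchronizes N T M Q) (hcard : 1 < G.basicBicomponents.card)
    {α : Finset (Fin N) → Fin N → ℝ} (hα : ∀ K ∈ G.basicBicomponents, G.IsAveraging K (α K))
    {e : Fin N → ℝ → E} (he : ∀ i, G.SolvesNode T M e i)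
    (havg : ∀ K ∈ G.basicBicomponents, ∀ t, ∑ i, α K i • e i t = 0) (i : Fin N) :
    Tendsto (fun t => Q (e i t)) atTop (𝓝 0) := by
  classical
  have hbasic : ∀ {K}, K ∈ G.basicBicomponents → G.IsBasicBicomponent K :=
    G.mem_basicBicomponents.1
  have hother : ∀ K ∈ G.basicBicomponents, ∃ l ∈ G.basicNodes, l ∉ K := by
    intro K hK
    obtain ⟨K', hK', hne⟩ := Finset.exists_mem_ne hcard K
    obtain ⟨l, hl⟩ := (hbasic hK').1.prop.1
    exact ⟨l, (hbasic hK').mem_basicNodes hl, fun h =>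
      hne ((hbasic hK').eq_of_mem (hbasic hK) hl h)⟩
  have hcont : ∀ i, Continuous (e i) := fun i =>
    continuous_iff_continuousAt.2 fun t => (he i t).continuousAt
  -- `u K` is the response of the nonbasic nodes to the bicomponent `K` alone; by superposition,
  -- `e - ∑ K, u K` vanishes on all the basic nodes.
  have hex : ∀ K : Finset (Fin N), ∃ u : Fin N → ℝ → E,
      (∀ i ∈ G.basicNodes, u i = if i ∈ K then e i else fun _ => 0) ∧
      ∀ i ∉ G.basicNodes, G.SolvesNode T M u i := by
    intro K
    refine G.exists_solvesNode T M G.basicNodes fun i _ => ?_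
    split_ifs
    exacts [hcont i, continuous_const]
  choose u hub hun using hex
  have huK : ∀ K ∈ G.basicBicomponents, ∀ i ∈ K, u K i = e i := by
    intro K hK i hi
    rw [hub K i ((hbasic hK).mem_basicNodes hi), if_pos hi]
  have hu : ∀ K ∈ G.basicBicomponents, Tendsto (fun t => Q (u K i t)) atTop (𝓝 0) := by
    intro K hK
    obtain ⟨l, hl, hlK⟩ := hother K hK
    refine tendsto_zero_of_average_eq_zero hsync (hbasic hK) (hα K hK) hl hlK ?_ ?_ (hun K) ?_ i
    · intro j hj hjK t
      rw [hub K j hj, if_neg hjK]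
    · intro j hj t
      rw [huK K hK j hj]
      refine (he j t).congr_deriv ?_
      congr 2
      refine Finset.sum_congr rfl fun k _ => ?_
      by_cases hk : k ∈ K
      · rw [huK K hK k hk]
      · simp [(hbasic hK).a_eq_zero hj hk]
    · intro t
      rw [← havg K hK t]
      refine Finset.sum_congr rfl fun j _ => ?_
      by_cases hj : j ∈ K
      · rw [huK K hK j hj]
      · simp [(hα K hK).eq_zero j hj]
  have hrest : Tendsto (fun t => Q (e i t - ∑ K ∈ G.basicBicomponents, u K i t)) atTop (𝓝 0) := by
    obtain ⟨K₀, hK₀⟩ := Finset.card_pos.1 (zero_lt_one.trans hcard)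
    obtain ⟨l, hl, hlK⟩ := hother K₀ hK₀
    have hzero : ∀ j ∈ G.basicNodes, ∀ t,
        e j t - ∑ K ∈ G.basicBicomponents, u K j t = 0 := by
      intro j hj t
      obtain ⟨K, hK, hjK⟩ := G.mem_basicNodes.1 hj
      rw [Finset.sum_eq_single_of_mem K hK, huK K hK j hjK, sub_self]
      intro K' hK' hne
      rw [hub K' j hj, if_neg fun h => hne ((hbasic hK').eq_of_mem (hbasic hK) h hjK)]
    refine tendsto_zero_of_average_eq_zero (u := fun j t => e j t -
      ∑ K ∈ G.basicBicomponents, u K j t) hsync (hbasic hK₀) (hα K₀ hK₀) hl hlK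
      (fun j hj _ => hzero j hj) ?_ ?_ ?_ i
    · intro j hj t
      have hjb := (hbasic hK₀).mem_basicNodes hj
      have h0 : ∀ k, G.a j k • ((e j t - ∑ K ∈ G.basicBicomponents, u K j t)
          - (e k t - ∑ K ∈ G.basicBicomponents, u K k t)) = 0 := by
        intro k
        by_cases hk : k ∈ K₀
        · rw [hzero j hjb, hzero k ((hbasic hK₀).mem_basicNodes hk), sub_self, smul_zero]
        · rw [(hbasic hK₀).a_eq_zero hj hk, zero_smul]
      simp only [h0, Finset.sum_const_zero, map_zero, add_zero]
      simp only [hzero j hjb, map_zero]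
      exact hasDerivAt_const t 0
    · intro j hj
      exact (he j).sub (SolvesNode.sum fun K _ => hun K j hj)
    · intro t
      refine Finset.sum_eq_zero fun j _ => ?_
      by_cases hj : j ∈ K₀
      · rw [hzero j ((hbasic hK₀).mem_basicNodes hj), smul_zero]
      · rw [(hα K₀ hK₀).eq_zero j hj, zero_smul]
  have hsum := hrest.add (tendsto_finsetSum G.basicBicomponents hu)
  simpa only [← map_sum, ← map_add, sub_add_cancel, Finset.sum_const_zero, add_zero] using hsum

/-- The deviation of a trajectory from the claimed limit behaviour is a trajectory as well. -/
theorem solvesNode_sub_betaExt {α : Finset (Fin N) → Fin N → ℝ}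
    (hα : ∀ K ∈ G.basicBicomponents, G.IsAveraging K (α K))
    {z : Fin N → ℝ → E} (hz : ∀ i, G.SolvesNode T M z i) (i : Fin N) :
    G.SolvesNode T M (fun i t => z i t -
      ∑ K ∈ G.basicBicomponents, G.betaExt K i • ∑ l, α K l • z l t) i :=
  (hz i).sub (SolvesNode.sum fun K hK => solvesNode_smul (fun t => (hα K hK).hasDerivAt hz t)
    ((G.mem_basicBicomponents.1 hK).sum_betaExt i))

/-- The deviation from the claimed limit behaviour has average zero over each basic bicomponent. -/
theorem IsAveraging.sum_smul_sub_betaExt {α : Finset (Fin N) → Fin N → ℝ} {K : Finset (Fin N)}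
    (hK : K ∈ G.basicBicomponents) (hα : G.IsAveraging K (α K)) (z : Fin N → E) :
    ∑ i, α K i • (z i - ∑ K' ∈ G.basicBicomponents, G.betaExt K' i • ∑ l, α K' l • z l) = 0 := by
  have h : ∀ i, α K i • (z i - ∑ K' ∈ G.basicBicomponents, G.betaExt K' i • ∑ l, α K' l • z l)
      = α K i • z i - α K i • ∑ l, α K l • z l := by
    intro i
    by_cases hi : i ∈ K
    · rw [sum_betaExt_smul_of_mem hK hi (fun K' => ∑ l, α K' l • z l), smul_sub]
    · simp [hα.eq_zero i hi]
  simp_rw [h]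
  rw [Finset.sum_sub_distrib, ← Finset.sum_smul, hα.sum_eq_one, one_smul, sub_self]

end WDigraph

/-! ### Agents with protocols -/

section Agents

/-- The linear map with the block matrix `[A, B; C, D]`. -/
def blockMap {𝕜 : Type*} [RCLike 𝕜] {n k : ℕ} (A : Matrix (Fin n) (Fin n) 𝕜)
    (B : Matrix (Fin n) (Fin k) 𝕜) (C : Matrix (Fin k) (Fin n) 𝕜) (D : Matrix (Fin k) (Fin k) 𝕜) :
    ((Fin n → 𝕜) × (Fin k → 𝕜)) →L[𝕜] ((Fin n → 𝕜) × (Fin k → 𝕜)) :=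
  LinearMap.toContinuousLinearMap
    ((A.mulVecLin.coprod B.mulVecLin).prod (C.mulVecLin.coprod D.mulVecLin))

theorem blockMap_apply {𝕜 : Type*} [RCLike 𝕜] {n k : ℕ} (A : Matrix (Fin n) (Fin n) 𝕜)
    (B : Matrix (Fin n) (Fin k) 𝕜) (C : Matrix (Fin k) (Fin n) 𝕜) (D : Matrix (Fin k) (Fin k) 𝕜)
    (z : (Fin n → 𝕜) × (Fin k → 𝕜)) :
    blockMap A B C D z = (A.mulVec z.1 + B.mulVec z.2, C.mulVec z.1 + D.mulVec z.2) :=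
  rfl

/-- Complexification of the state of an agent and its protocol. -/
def complexify (n k : ℕ) : ((Fin n → ℝ) × (Fin k → ℝ)) →L[ℝ] ((Fin n → ℂ) × (Fin k → ℂ)) :=
  (ContinuousLinearMap.pi fun i => Complex.ofRealCLM.comp (ContinuousLinearMap.proj i)).prodMap
    (ContinuousLinearMap.pi fun i => Complex.ofRealCLM.comp (ContinuousLinearMap.proj i))

theorem complexify_blockMap {n k : ℕ} (A : Matrix (Fin n) (Fin n) ℝ)
    (B : Matrix (Fin n) (Fin k) ℝ) (C : Matrix (Fin k) (Fin n) ℝ) (D : Matrix (Fin k) (Fin k) ℝ)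
    (z : (Fin n → ℝ) × (Fin k → ℝ)) :
    complexify n k (blockMap A B C D z) = blockMap (A.map Complex.ofReal) (B.map Complex.ofReal)
      (C.map Complex.ofReal) (D.map Complex.ofReal) (complexify n k z) := by
  ext i <;> simp [complexify, blockMap_apply, Matrix.mulVec, dotProduct]

variable {n m p nc : ℕ} (S : AgentModel n m p) (P : LinProtocol nc m p)

/-- The dynamics of an agent and its protocol in the absence of measurements. -/
def drift : ((Fin n → ℝ) × (Fin nc → ℝ)) →L[ℝ] ((Fin n → ℝ) × (Fin nc → ℝ)) :=
  blockMap S.A (S.B * P.Fc) 0 P.Ac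

/-- The effect of the relative measurement on an agent and its protocol. -/
def coupling : ((Fin n → ℝ) × (Fin nc → ℝ)) →L[ℝ] ((Fin n → ℝ) × (Fin nc → ℝ)) :=
  blockMap (S.B * P.Gc * S.C) 0 (P.Bc * S.C) 0

variable {S P}

theorem isTrajectory_iff {N : ℕ} {G : WDigraph N} {x : Fin N → ℝ → Fin n → ℝ}
    {xc : Fin N → ℝ → Fin nc → ℝ} : IsTrajectory S P G x xc ↔
      ∀ i, G.SolvesNode (drift S P) (coupling S P) (fun i t => (x i t, xc i t)) i := by
  refine forall_congr' fun i => forall_congr' fun t => ?_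
  have hζ : relMeasurement S G (fun j => x j t) i
      = S.C.mulVec (∑ j, G.a i j • (x i t - x j t)) := by
    simp [relMeasurement, Matrix.mulVec_sum, Matrix.mulVec_smul, Matrix.mulVec_sub]
  have hfst : (∑ j, G.a i j • ((x i t, xc i t) - (x j t, xc j t))).1
      = ∑ j, G.a i j • (x i t - x j t) := by
    simp [Prod.fst_sum]
  have hrhs : drift S P (x i t, xc i t)
        + coupling S P (∑ j, G.a i j • ((x i t, xc i t) - (x j t, xc j t)))
      = (S.A.mulVec (x i t) + S.B.mulVec (P.Fc.mulVec (xc i t)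
          + P.Gc.mulVec (relMeasurement S G (fun j => x j t) i)),
        P.Ac.mulVec (xc i t) + P.Bc.mulVec (relMeasurement S G (fun j => x j t) i)) := by
    rw [drift, coupling, blockMap_apply, blockMap_apply, hfst, hζ]
    ext k <;> simp [Matrix.mulVec_add, Matrix.mulVec_mulVec, Matrix.mul_assoc, add_assoc]
  rw [hrhs]
  exact ⟨fun h => h.1.prodMk h.2, fun h => ⟨h.fst, h.snd⟩⟩

theorem SolvesScaleFree.synchronizes (hP : SolvesScaleFree S P) (N : ℕ) :
    WDigraph.Synchronizes N (drift S P) (coupling S P) (ContinuousLinearMap.fst ℝ _ _) := by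
  intro G hG z hz i j
  exact hP N G hG (fun i t => (z i t).1) (fun i t => (z i t).2) (isTrajectory_iff.2 hz) i j

/-- If `(B F_c, A_c)` is detectable, then a network trajectory whose agent states tend to zero tends
to zero. The detectability condition passes to the whole network with the agent states as output,
because the measurements vanish along with the agent states. -/
theorem tendsto_zero_of_fst_tendsto_zero (hdet : IsDetectable (S.B * P.Fc) P.Ac) {N : ℕ}
    {G : WDigraph N} {e : Fin N → ℝ → (Fin n → ℝ) × (Fin nc → ℝ)}
    (he : ∀ i, G.SolvesNode (drift S P) (coupling S P) e i)
    (hfst : ∀ i, Tendsto (fun t => (e i t).1) atTop (𝓝 0)) (i : Fin N) :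
    Tendsto (e i) atTop (𝓝 0) := by
  let Tc := blockMap (S.A.map Complex.ofReal) ((S.B * P.Fc).map Complex.ofReal)
    ((0 : Matrix (Fin nc) (Fin n) ℝ).map Complex.ofReal) (P.Ac.map Complex.ofReal)
  let Mc := blockMap ((S.B * P.Gc * S.C).map Complex.ofReal)
    ((0 : Matrix (Fin n) (Fin nc) ℝ).map Complex.ofReal) ((P.Bc * S.C).map Complex.ofReal)
    ((0 : Matrix (Fin nc) (Fin nc) ℝ).map Complex.ofReal)
  let π : Fin N → (Fin N → (Fin n → ℂ) × (Fin nc → ℂ)) →L[ℂ] (Fin n → ℂ) × (Fin nc → ℂ) :=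
    ContinuousLinearMap.proj
  let A : (Fin N → (Fin n → ℂ) × (Fin nc → ℂ)) →L[ℂ] (Fin N → (Fin n → ℂ) × (Fin nc → ℂ)) :=
    ContinuousLinearMap.pi fun i => Tc.comp (π i) + Mc.comp
      (∑ j, (G.a i j : ℂ) • (π i - π j))
  let Q : (Fin N → (Fin n → ℂ) × (Fin nc → ℂ)) →L[ℂ] (Fin N → Fin n → ℂ) :=
    ContinuousLinearMap.pi fun i =>
      (ContinuousLinearMap.fst ℂ (Fin n → ℂ) (Fin nc → ℂ)).comp (π i)
  have hA : ∀ w i, A w i = Tc (w i) + Mc (∑ j, (G.a i j : ℂ) • (w i - w j)) := by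
    intro w i
    simp [A, π]
  have hMc : ∀ w, w.1 = 0 → Mc w = 0 := by
    intro w hw
    simp [Mc, blockMap_apply, hw]
  have hlim : Tendsto (fun t i => complexify n nc (e i t)) atTop (𝓝 0) := by
    refine tendsto_zero_of_output_tendsto_zero A Q ?_ ?_ ?_
    · intro μ v hμ hv hQ
      have hv1 : ∀ i, (v i).1 = 0 := fun i => congrFun hQ i
      have hrow : ∀ i, Tc (v i) = μ • v i := by
        intro i
        have h := congrFun hv i
        rw [hA] at h
        have h0 : (∑ j, (G.a i j : ℂ) • (v i - v j)).1 = 0 := by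
          simp [Prod.fst_sum, hv1]
        rwa [hMc _ h0, add_zero] at h
      refine funext fun i => Prod.ext (hv1 i) (hdet μ (v i).2 hμ ?_ ?_)
      · simpa [Tc, blockMap_apply, hv1 i] using congrArg Prod.snd (hrow i)
      · simpa [Tc, blockMap_apply, hv1 i] using congrArg Prod.fst (hrow i)
    · intro t
      refine hasDerivAt_pi.2 fun i => ?_
      refine ((complexify n nc).hasFDerivAt.comp_hasDerivAt t (he i t)).congr_deriv ?_
      rw [hA, map_add, drift, coupling, complexify_blockMap, complexify_blockMap]
      simp only [map_sum, map_smul, map_sub, Complex.coe_smul]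
      rfl
    · refine tendsto_pi_nhds.2 fun i => tendsto_pi_nhds.2 fun k => ?_
      have h := (Complex.continuous_ofReal.tendsto 0).comp (tendsto_pi_nhds.1 (hfst i) k)
      simpa [Q, π, complexify, Function.comp_def] using h
  have hi := tendsto_pi_nhds.1 hlim i
  refine Tendsto.prodMk_nhds (hfst i) (tendsto_pi_nhds.2 fun k => ?_)
  have h := (Complex.continuous_re.tendsto 0).comp
    (tendsto_pi_nhds.1 ((continuous_snd.tendsto _).comp hi) k)
  simpa [complexify, Function.comp_def] using h

end Agents

end

theorem theorem2 {n m p nc : ℕ} (S : AgentModel n m p) (P : LinProtocol nc m p)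
    (hP : SolvesScaleFree S P) {N : ℕ} (hN : 0 < N) (G : WDigraph N)
    (hG : ¬ G.HasDirectedSpanningTree) :
    -- there are `k > 1` basic bicomponents
    1 < G.basicBicomponents.card ∧
    -- the coefficients `β` are well defined, nonnegative and sum up to one
    IsUnit G.L0.det ∧
    (∀ K ∈ G.basicBicomponents, ∀ j, 0 ≤ G.beta K j) ∧
    (∀ j, ∑ K ∈ G.basicBicomponents, G.beta K j = 1) ∧
    -- the weights of the linear combinations of initial conditions in the basic bicomponents
    ∃ α : (K : Finset (Fin N)) → K → ℝ,
      (∀ K ∈ G.basicBicomponents,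
        (∀ l, 0 ≤ α K l) ∧ ∑ l, α K l = 1 ∧ Matrix.vecMul (α K) (G.Lblock K) = 0) ∧
      ∀ (x : Fin N → ℝ → Fin n → ℝ) (xc : Fin N → ℝ → Fin nc → ℝ), IsTrajectory S P G x xc →
        -- the synchronized trajectories of the basic bicomponents
        ∃ (xs : Finset (Fin N) → ℝ → Fin n → ℝ) (xsc : Finset (Fin N) → ℝ → Fin nc → ℝ),
          (∀ K ∈ G.basicBicomponents,
            (∀ t, HasDerivAt (fun τ => Sum.elim (xs K τ) (xsc K τ))
              ((Atilde S P).mulVec (Sum.elim (xs K t) (xsc K t))) t) ∧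
            xs K 0 = ∑ l : K, α K l • x l 0 ∧
            xsc K 0 = ∑ l : K, α K l • xc l 0) ∧
          -- agent states
          (∀ K ∈ G.basicBicomponents, ∀ i ∈ K,
            Tendsto (fun t => x i t - xs K t) atTop (𝓝 0) ∧
            ∀ j ∈ K, Tendsto (fun t => x i t - x j t) atTop (𝓝 0)) ∧
          (∀ j : G.NonBasic,
            Tendsto (fun t => x j t - ∑ K ∈ G.basicBicomponents, G.beta K j • xs K t)
              atTop (𝓝 0)) ∧
          -- protocol states
          (IsDetectable (S.B * P.Fc) P.Ac →
            (∀ K ∈ G.basicBicomponents, ∀ i ∈ K,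
              Tendsto (fun t => xc i t - xsc K t) atTop (𝓝 0) ∧
              ∀ j ∈ K, Tendsto (fun t => xc i t - xc j t) atTop (𝓝 0)) ∧
            (∀ j : G.NonBasic,
              Tendsto (fun t => xc j t - ∑ K ∈ G.basicBicomponents, G.beta K j • xsc K t)
                atTop (𝓝 0))) := by
  have hcard := G.one_lt_card_basicBicomponents hN hG
  have hex : ∀ K : Finset (Fin N), ∃ α, K ∈ G.basicBicomponents → G.IsAveraging K α := by
    intro K
    by_cases hK : K ∈ G.basicBicomponents
    · obtain ⟨α, hα⟩ := (G.mem_basicBicomponents.1 hK).exists_isAveraging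
      exact ⟨α, fun _ => hα⟩
    · exact ⟨0, fun h => absurd h hK⟩
  choose α hα using hex
  refine ⟨hcard, G.isUnit_L0_det, fun K hK => (G.mem_basicBicomponents.1 hK).beta_nonneg,
    G.sum_beta, fun K l => α K l, ?_, ?_⟩
  · intro K hK
    refine ⟨fun l => (hα K hK).nonneg l, ?_, ?_⟩
    · simpa [(hα K hK).sum_eq_one] using (hα K hK).sum_coe fun _ => (1 : ℝ)
    · ext j
      exact ((hα K hK).sum_coe fun l => G.laplacian l j).trans
        (congrFun (hα K hK).vecMul_eq_zero j)
  intro x xc hx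
  have hz := isTrajectory_iff.1 hx
  -- All the claims on trajectories say that components of the deviation `e` tend to zero.
  have he := WDigraph.solvesNode_sub_betaExt hα hz
  have hlim := WDigraph.tendsto_zero_of_forall_average_eq_zero (hP.synchronizes N) hcard hα he
    (fun K hK t => (hα K hK).sum_smul_sub_betaExt hK fun l => (x l t, xc l t))
  have hbeta : ∀ (K : Finset (Fin N)) (j : G.NonBasic), G.betaExt K j = G.beta K j := by
    intro K j
    simp [WDigraph.betaExt, j.2]
  have hsub : ∀ {d : ℕ} {y : Fin N → ℝ → Fin d → ℝ} {s : ℝ → Fin d → ℝ} {K : Finset (Fin N)},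
      (∀ i ∈ K, Tendsto (fun t => y i t - s t) atTop (𝓝 0)) → ∀ i ∈ K,
      Tendsto (fun t => y i t - s t) atTop (𝓝 0) ∧
        ∀ j ∈ K, Tendsto (fun t => y i t - y j t) atTop (𝓝 0) := by
    intro d y s K h i hi
    exact ⟨h i hi, fun j hj => by simpa using (h i hi).sub (h j hj)⟩
  refine ⟨fun K t => ∑ l, α K l • x l t, fun K t => ∑ l, α K l • xc l t, ?_, ?_, ?_, ?_⟩
  · intro K hK
    refine ⟨fun t => ?_, ((hα K hK).sum_coe fun l => x l 0).symm,
      ((hα K hK).sum_coe fun l => xc l 0).symm⟩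
    have h := (hα K hK).hasDerivAt hz t
    have hpair : ∀ t, ∑ l, α K l • (x l t, xc l t)
        = (∑ l, α K l • x l t, ∑ l, α K l • xc l t) := by
      intro t
      ext k <;> simp [Prod.fst_sum, Prod.snd_sum]
    simp only [hpair, drift, blockMap_apply, Matrix.zero_mulVec, zero_add] at h
    rw [Atilde, Matrix.fromBlocks_mulVec]
    simp only [Sum.elim_comp_inl, Sum.elim_comp_inr, Matrix.zero_mulVec, zero_add]
    refine hasDerivAt_pi.2 ?_
    rintro (k | k)
    · exact hasDerivAt_pi.1 h.fst k
    · exact hasDerivAt_pi.1 h.snd k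
  · intro K hK
    refine hsub fun i hi => (hlim i).congr fun t => ?_
    rw [WDigraph.sum_betaExt_smul_of_mem hK hi fun K => ∑ l, α K l • (x l t, xc l t)]
    simp [Prod.fst_sum]
  · intro j
    refine (hlim j).congr fun t => ?_
    simp [Prod.fst_sum, hbeta]
  · intro hdet
    have hlimc := fun i =>
      (continuous_snd.tendsto _).comp (tendsto_zero_of_fst_tendsto_zero hdet he hlim i)
    refine ⟨?_, ?_⟩
    · intro K hK
      refine hsub fun i hi => (hlimc i).congr fun t => ?_
      rw [Function.comp_apply,
        WDigraph.sum_betaExt_smul_of_mem hK hi fun K => ∑ l, α K l • (x l t, xc l t)]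
      simp [Prod.snd_sum]
    · intro j
      refine (hlimc j).congr fun t => ?_
      simp [Prod.snd_sum, hbeta]
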